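/- **Setting.** Let $f\ge 0$. There are $N=3f+1$ replicas $0,\dots,N-1$, of which at most $f$ are Byzantine; the others are correct. Messages are signed, and the network is asynchronous: messages may be delayed arbitrarily, reordered, duplicated or lost. A Byzantine replica may send any messages under its own signature, but cannot forge the signature of a correct replica. The hash function $h$ has no collisions. An *agreement slot* is a pair $s=\langle r, sc\rangle$ of a replica $r$, the request coordinator of $s$, and a counter $sc$; a *dependency set* is a finite set of slots. For each slot $s$ every correct replica $i$ keeps a view number, initially $-1$, and runs the following protocol. (Timers, the waiting for dependencies and the way in which a correct replica computes dependency sets are unrestricted. There is no checkpointing.) *Fast path (view $-1$).* The coordinator $co=r$ sends at most one $dp=\langle \mathrm{DepPropose}, s, co, h(c), D, F\rangle$ for the slot, together with the request $c$, where $F$ is a set of $2f$ replicas other than $co$. A follower accepts the first valid DepPropose with a matching request and, if it is in $F$, sends one $\langle \mathrm{DepVerify}, s, i, h(dp), D_i\rangle$. The pair $(dp,\vec{dv})$ is *verified* if $\vec{dv}$ consists of $2f$ DepVerifys with hash $h(dp)$ from different replicas in $F$. It is *fp-verified* if, in addition, every dependency in $\vec{dv}$ occurs in at least $f+1$ of the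 DepVerifys. A replica that has fp-verified $(dp,\vec{dv})$ sends $\langle \mathrm{DepCommit}, s, i, h(\vec{dv})\rangle$, and it *commits on the fast path* when it has DepCommits with this hash from $2f+1$ replicas. *Reconciliation path (view $v$).* In view $-1$, a replica whose verified $(dp,\vec{dv})$ is not fp-verified sends $\langle \mathrm{Prepare}, -1, s, i, h(\vec{dv})\rangle$ and no DepCommit. In a view $v\ge 0$, it sends $\langle \mathrm{Prepare}, v, s, i, h(\vec{dv})\rangle$ for the content of the NewView it accepted. With matching Prepares of view $v$ from $2f+1$ replicas the slot is *rp-prepared*, and the replica sends $\langle \mathrm{Commit}, v, s, i, h(\vec{dv})\rangle$; it *commits on the reconciliation path* when it then has matching Commits of view $v$ from $2f+1$ replicas. *View change.* At any time a replica may leave its view for a higher view $v$. It then stops taking part in lower views and sends $\langle \mathrm{ViewChange}, v, s, i, cert\rangle$. Here $cert$ is its certificate from the latest view in which it obtained one, if any: a *fast-path certificate* (FPC) $(dp,c,\vec{dv})$ from fp-verifying in view $-1$, or a *reconciliation-path certificate* (RPC), which consists of $(dp,c,\vec{dv})$ and the $2f+1$ Prepares of one view from rp-preparing in that view. Certificates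 are valid only if all the messages in them are validly signed and match. The coordinator $(r+v)\bmod N$ of view $v$ collects valid ViewChanges for $v$ from $2f+1$ replicas and selects the content of an RPC of the highest view among them; if there is no RPC, that of an FPC; if there is no certificate, the no-op with $\vec{dv}=\emptyset$. It sends the result with these ViewChanges in a NewView. A replica in view $v$ that waits for the new view accepts one NewView for $v$, provided that it was correctly computed. *Result of a commit.* Committing $(dp,c,\vec{dv})$ on either path commits the request $c$ with the dependency set $\bigcup_{\langle \mathrm{DepVerify},s,j,\cdot,D_j\rangle\in\vec{dv}}D_j$; for the no-op this set is empty. A replica that has committed $(c,D)$ for $s$ may send $\langle \mathrm{Exec}, s, i, c, D\rangle$, and a replica that receives $f+1$ Execs with the same $s,c,D$ from different replicas *commits $(c,D)$ through Exec messages*. **Theorem (Consistency).** In every run of the protocol, if a correct replica commits $(c,D)$ for a slot $s$ and a correct replica (the same or another one) commits $(c',D')$ for $s$, at any times, each on the fast path, on the reconciliation path in any view, or through $f+1$ Exec messages, then $c=c'$ and $D=D'$. The same holds for the variant of the protocol in which the dependency set of the DepPropose is added to the committed dependency set, and fp-verified requires only that each dependency in $\vec{dv}$ that is not in the DepPropose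 occurs in at least $f+1$ of the DepVerifys. -/

import Mathlib

/-!
The agreement protocol of a leaderless Byzantine fault-tolerant replication system with `3f+1`
replicas, as a labelled-message transition system: a fast path, a reconciliation path, per-slot view
changes, and a catch-up mechanism through `Exec` messages.

The network is asynchronous: `State.sent` is the set of all signed messages produced so far, and a
correct replica may at any time receive, or never receive, any of them.  A signature of `i` on `m`
verifies iff `m ∈ sent`; a message signed by a correct replica gets into `sent` only when that
replica sends it, a Byzantine replica may put in any message that it signs itself.

Everything that only matters for liveness or for the execution stage is left open, which allows more
runs: timers may fire at any time, the blocking `wait` on dependencies may return at any time, and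
the dependency set that a correct replica computes for a request may be any finite set of slots.
-/

namespace Isos

/-- The `N = 3f+1` replicas. -/
abbrev Replica (f : ℕ) : Type := Fin (3 * f + 1)

/-- Agreement slots `⟨r, sc⟩`: the request coordinator and its local counter. -/
abbrev Slot (f : ℕ) : Type := Replica f × ℕ

/-- `⟨DepPropose, s, co, h(r), D, F⟩`, signed by `co`. -/
@[ext] structure DepPropose (f : ℕ) (H : Type*) where
  slot : Slot f
  sender : Replica f
  reqHash : H
  deps : Finset (Slot f)
  quorum : Finset (Replica f)

/-- `⟨DepVerify, s, i, h(dp), D⟩`, signed by `i`. -/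
@[ext] structure DepVerify (f : ℕ) (H : Type*) where
  slot : Slot f
  sender : Replica f
  proposeHash : H
  deps : Finset (Slot f)

/-- `⟨DepCommit, s, i, h(dv)⟩`, signed by `i`. -/
@[ext] structure DepCommit (f : ℕ) (H : Type*) where
  slot : Slot f
  sender : Replica f
  verifiesHash : H

/-- `⟨Prepare, v, s, i, h(dv)⟩`, signed by `i`. -/
@[ext] structure Prepare (f : ℕ) (H : Type*) where
  view : ℤ
  slot : Slot f
  sender : Replica f
  verifiesHash : H

/-- `⟨Commit, v, s, i, h(dv)⟩`, signed by `i`. -/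
@[ext] structure Commit (f : ℕ) (H : Type*) where
  view : ℤ
  slot : Slot f
  sender : Replica f
  verifiesHash : H

/-- A `DepPropose` together with the full request; `none` is the no-op (null) proposal. -/
abbrev Proposal (f : ℕ) (Req H : Type*) : Type _ := Option (DepPropose f H × Req)

/-- Fast-path certificates (for view `-1`) and reconciliation-path certificates. -/
inductive Certificate (f : ℕ) (Req H : Type*) where
  | fpc (dp : DepPropose f H) (r : Req) (dv : Finset (DepVerify f H))
  | rpc (p : Proposal f Req H) (dv : Finset (DepVerify f H)) (prep : Finset (Prepare f H)) (view : ℤ)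

/-- `⟨ViewChange, v, s, i, certificate⟩`, signed by `i`; the certificate is optional. -/
structure ViewChange (f : ℕ) (Req H : Type*) where
  view : ℤ
  slot : Slot f
  sender : Replica f
  cert : Option (Certificate f Req H)

/-- `⟨NewView, v, s, co, dp, dv, VCS⟩`, signed by `co`. -/
structure NewView (f : ℕ) (Req H : Type*) where
  view : ℤ
  slot : Slot f
  sender : Replica f
  proposal : Proposal f Req H
  verifies : Finset (DepVerify f H)
  vcs : Finset (ViewChange f Req H)

/-- `⟨Exec, s, i, c, D⟩`, signed by `i`; the request `none` is the no-op. -/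
structure Exec (f : ℕ) (Req : Type*) where
  slot : Slot f
  sender : Replica f
  request : Option Req
  deps : Finset (Slot f)

/-- Signed protocol messages. -/
inductive Msg (f : ℕ) (Req H : Type*) where
  | depPropose (m : DepPropose f H)
  | depVerify (m : DepVerify f H)
  | depCommit (m : DepCommit f H)
  | prepare (m : Prepare f H)
  | commit (m : Commit f H)
  | viewChange (m : ViewChange f Req H)
  | newView (m : NewView f Req H)
  | exec (m : Exec f Req)

/-- The replica whose signature is on the message. -/
def Msg.signer {f : ℕ} {Req H : Type*} : Msg f Req H → Replica f
  | .depPropose m => m.sender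
  | .depVerify m => m.sender
  | .depCommit m => m.sender
  | .prepare m => m.sender
  | .commit m => m.sender
  | .viewChange m => m.sender
  | .newView m => m.sender
  | .exec m => m.sender

/-- The hash `h`, on the three kinds of data that the protocol hashes. -/
structure Hash (f : ℕ) (Req H : Type*) where
  request : Req → H
  propose : DepPropose f H → H
  verifies : Finset (DepVerify f H) → H

/-- Collision resistance, idealised as the absence of collisions. -/
def Hash.CollisionFree {f : ℕ} {Req H : Type*} (h : Hash f Req H) : Prop :=
  Function.Injective h.request ∧ Function.Injective h.propose ∧ Function.Injective h.verifies

/-- The two variants of combining dependency sets: only those of the `DepVerify`s are used, or the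
set of the `DepPropose` is used as well. -/
inductive DepRule where
  | verifiesOnly
  | withPropose

/-- What the `DepPropose` contributes to the dependency set of its request. -/
def DepRule.base {f : ℕ} {H : Type*} : DepRule → DepPropose f H → Finset (Slot f)
  | .verifiesOnly, _ => ∅
  | .withPropose, dp => dp.deps

/-- The dependency set that is committed with `dp` (`none` for the no-op) and `dv`. -/
def DepRule.result {f : ℕ} {H : Type*} (rule : DepRule) (dp : Option (DepPropose f H))
    (dv : Finset (DepVerify f H)) : Finset (Slot f) :=
  (dp.elim ∅ rule.base) ∪ dv.biUnion (fun m => m.deps)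

/-- The condition for the fast path: each dependency in the `DepVerify`s (beyond the contribution of
the `DepPropose`) is reported by at least `f+1` of them. -/
def FastDeps {f : ℕ} {H : Type*} (rule : DepRule) (dp : DepPropose f H)
    (dv : Finset (DepVerify f H)) : Prop :=
  ∀ d ∈ dv.biUnion (fun m => m.deps), d ∉ rule.base dp → f + 1 ≤ (dv.filter (fun m => d ∈ m.deps)).card

/-- The progress of a replica in a slot. -/
inductive Phase where
  | init | proposed | fpVerified | fpCommitted | rpVerified | rpPrepared | rpCommitted | viewChange

/-- The variables `p, pr, v, step, view, cert, exec` of a replica for one slot. -/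
structure SlotState (f : ℕ) (Req H : Type*) where
  propose : Option (DepPropose f H)
  request : Option Req
  verifies : Finset (DepVerify f H)
  phase : Phase
  view : ℤ
  cert : Option (Certificate f Req H)
  /-- The committed request (`none` for the no-op) and dependency set, if any. -/
  exec : Option (Option Req × Finset (Slot f))

/-- Views of a slot start at `-1`. -/
def SlotState.initial (f : ℕ) (Req H : Type*) : SlotState f Req H where
  propose := none
  request := none
  verifies := ∅
  phase := .init
  view := -1
  cert := none
  exec := none

/-- A global state: the local states of the replicas and all messages sent so far. -/
structure State (f : ℕ) (Req H : Type*) where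
  loc : Replica f → Slot f → SlotState f Req H
  sent : Set (Msg f Req H)

def State.initial (f : ℕ) (Req H : Type*) : State f Req H where
  loc := fun _ _ => SlotState.initial f Req H
  sent := ∅

/-- Replica `i` changes its state for slot `s` to `l` and sends the messages `ms`. -/
def State.update {f : ℕ} {Req H : Type*} (σ : State f Req H) (i : Replica f) (s : Slot f)
    (l : SlotState f Req H) (ms : Set (Msg f Req H)) : State f Req H where
  loc := Function.update σ.loc i (Function.update (σ.loc i) s l)
  sent := σ.sent ∪ ms

/-- A valid `DepPropose` for slot `s`: it is signed by the coordinator of the slot and its fast-path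
quorum consists of `2f` followers. -/
def ValidPropose {f : ℕ} {Req H : Type*} (σ : State f Req H) (s : Slot f)
    (dp : DepPropose f H) : Prop :=
  .depPropose dp ∈ σ.sent ∧ dp.slot = s ∧ dp.sender = s.1 ∧ s.1 ∉ dp.quorum ∧ dp.quorum.card = 2 * f

/-- `dp` and `dv` verify slot `s`: `dp` is valid, and `dv` consists of `2f` matching `DepVerify`s
from different replicas, each in the fast-path quorum of `dp`. -/
def Verified {f : ℕ} {Req H : Type*} (h : Hash f Req H) (σ : State f Req H) (s : Slot f)
    (dp : DepPropose f H) (dv : Finset (DepVerify f H)) : Prop :=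
  ValidPropose σ s dp ∧ dv.card = 2 * f ∧ Set.InjOn DepVerify.sender (dv : Set (DepVerify f H)) ∧
    ∀ m ∈ dv, .depVerify m ∈ σ.sent ∧ m.slot = s ∧ m.sender ∈ dp.quorum ∧ m.proposeHash = h.propose dp

/-- `prep` consists of `Prepare`s for view `v` with hash `x` from `2f+1` different replicas. -/
def PrepareQuorum {f : ℕ} {Req H : Type*} (σ : State f Req H) (s : Slot f) (v : ℤ) (x : H)
    (prep : Finset (Prepare f H)) : Prop :=
  2 * f + 1 ≤ prep.card ∧ Set.InjOn Prepare.sender (prep : Set (Prepare f H)) ∧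
    ∀ m ∈ prep, .prepare m ∈ σ.sent ∧ m.view = v ∧ m.slot = s ∧ m.verifiesHash = x

/-- Validity of a certificate for slot `s`.  All embedded signatures are checked. -/
def ValidCert {f : ℕ} {Req H : Type*} (h : Hash f Req H) (rule : DepRule) (σ : State f Req H)
    (s : Slot f) : Certificate f Req H → Prop
  | .fpc dp r dv => Verified h σ s dp dv ∧ h.request r = dp.reqHash ∧ FastDeps rule dp dv
  | .rpc (some (dp, r)) dv prep v =>
      Verified h σ s dp dv ∧ h.request r = dp.reqHash ∧ PrepareQuorum σ s v (h.verifies dv) prep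
  | .rpc none dv prep v => dv = ∅ ∧ PrepareQuorum σ s v (h.verifies dv) prep

/-- A valid `ViewChange` for view `v` of slot `s`. -/
def ValidViewChange {f : ℕ} {Req H : Type*} (h : Hash f Req H) (rule : DepRule)
    (σ : State f Req H) (s : Slot f) (v : ℤ) (m : ViewChange f Req H) : Prop :=
  .viewChange m ∈ σ.sent ∧ m.slot = s ∧ m.view = v ∧ ∀ c ∈ m.cert, ValidCert h rule σ s c

/-- The certificate selection: a reconciliation-path certificate of the highest view, otherwise a
fast-path certificate, otherwise the no-op. -/
def Selects {f : ℕ} {Req H : Type*} (vcs : Finset (ViewChange f Req H)) (p : Proposal f Req H)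
    (dv : Finset (DepVerify f H)) : Prop :=
  (∃ m ∈ vcs, ∃ prep w, m.cert = some (.rpc p dv prep w) ∧
    ∀ m' ∈ vcs, ∀ p' dv' prep' w', m'.cert = some (.rpc p' dv' prep' w') → w' ≤ w) ∨
  ((∀ m' ∈ vcs, ∀ p' dv' prep' w', m'.cert ≠ some (.rpc p' dv' prep' w')) ∧
    ∃ m ∈ vcs, ∃ dp r, m.cert = some (.fpc dp r dv) ∧ p = some (dp, r)) ∨
  ((∀ m' ∈ vcs, m'.cert = none) ∧ p = none ∧ dv = ∅)

/-- The coordinator `(s.r + max(0, v)) mod N` of view `v` of slot `s`. -/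
def viewCoordinator {f : ℕ} (s : Slot f) (v : ℤ) : Replica f :=
  ⟨(s.1.val + v.toNat) % (3 * f + 1), Nat.mod_lt _ (Nat.succ_pos _)⟩

/-- A correctly computed `NewView`: it is from the coordinator of its view, carries valid
`ViewChange`s of `2f+1` different replicas, and its content is selected from their certificates. -/
def ValidNewView {f : ℕ} {Req H : Type*} (h : Hash f Req H) (rule : DepRule)
    (σ : State f Req H) (m : NewView f Req H) : Prop :=
  m.sender = viewCoordinator m.slot m.view ∧
    2 * f + 1 ≤ m.vcs.card ∧ Set.InjOn ViewChange.sender (m.vcs : Set (ViewChange f Req H)) ∧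
    (∀ c ∈ m.vcs, ValidViewChange h rule σ m.slot m.view c) ∧ Selects m.vcs m.proposal m.verifies

/-- The certificate that a replica with slot state `l` reports when it leaves its current view: a
new one if the slot is fp-verified or rp-prepared in this view, otherwise the one it had before. -/
def UpdatedCert {f : ℕ} {Req H : Type*} (h : Hash f Req H) (σ : State f Req H) (s : Slot f)
    (l : SlotState f Req H) (c : Option (Certificate f Req H)) : Prop :=
  match l.phase with
  | .fpVerified | .fpCommitted =>
      ∃ dp r, l.propose = some dp ∧ l.request = some r ∧ c = some (.fpc dp r l.verifies)
  | .rpPrepared | .rpCommitted =>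
      ∃ p prep, l.propose = Option.map Prod.fst p ∧ l.request = Option.map Prod.snd p ∧
        PrepareQuorum σ s l.view (h.verifies l.verifies) prep ∧
        c = some (.rpc p l.verifies prep l.view)
  | _ => c = l.cert

open Classical in
/-- One step of the system, in which the replicas in `byz` are Byzantine. -/
inductive Step {f : ℕ} {Req H : Type*} (h : Hash f Req H) (rule : DepRule)
    (byz : Finset (Replica f)) (σ : State f Req H) : State f Req H → Prop
  /-- The coordinator proposes a request in one of its unused slots. -/
  | propose (i : Replica f) (s : Slot f) (r : Req) (D : Finset (Slot f)) (F : Finset (Replica f))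
      (correct : i ∉ byz) (own : i = s.1)
      (view : (σ.loc i s).view = -1) (phase : (σ.loc i s).phase = .init)
      (quorum : i ∉ F ∧ F.card = 2 * f) :
      Step h rule byz σ (σ.update i s
        { σ.loc i s with
          propose := some ⟨s, i, h.request r, D, F⟩, request := some r, phase := .proposed }
        {.depPropose ⟨s, i, h.request r, D, F⟩})
  /-- A follower accepts the first valid `DepPropose`, with its request; if it is in the fast-path
  quorum, it answers with a `DepVerify` that has its own dependency set. -/
  | accept (i : Replica f) (s : Slot f) (dp : DepPropose f H) (r : Req) (D : Finset (Slot f))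
      (correct : i ∉ byz) (follower : i ≠ s.1)
      (view : (σ.loc i s).view = -1) (phase : (σ.loc i s).phase = .init)
      (valid : ValidPropose σ s dp) (request : h.request r = dp.reqHash) :
      Step h rule byz σ (σ.update i s
        { σ.loc i s with propose := some dp, request := some r, phase := .proposed }
        {m | i ∈ dp.quorum ∧ m = .depVerify ⟨s, i, h.propose dp, D⟩})
  /-- A replica stores the first matching `DepVerify` of a member of the fast-path quorum. -/
  | receiveVerify (i : Replica f) (s : Slot f) (dp : DepPropose f H) (m : DepVerify f H)
      (correct : i ∉ byz)
      (view : (σ.loc i s).view = -1) (phase : (σ.loc i s).phase = .proposed)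
      (propose : (σ.loc i s).propose = some dp)
      (sent : .depVerify m ∈ σ.sent) (slot : m.slot = s)
      (quorum : m.sender ∈ dp.quorum) (hash : m.proposeHash = h.propose dp)
      (first : ∀ m' ∈ (σ.loc i s).verifies, m'.sender ≠ m.sender) :
      Step h rule byz σ (σ.update i s
        { σ.loc i s with verifies := insert m (σ.loc i s).verifies } ∅)
  /-- The slot becomes fp-verified. -/
  | fpVerify (i : Replica f) (s : Slot f) (dp : DepPropose f H)
      (correct : i ∉ byz)
      (view : (σ.loc i s).view = -1) (phase : (σ.loc i s).phase = .proposed)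
      (propose : (σ.loc i s).propose = some dp)
      (verified : Verified h σ s dp (σ.loc i s).verifies)
      (fast : FastDeps rule dp (σ.loc i s).verifies) :
      Step h rule byz σ (σ.update i s
        { σ.loc i s with phase := .fpVerified }
        {.depCommit ⟨s, i, h.verifies (σ.loc i s).verifies⟩})
  /-- The slot becomes fp-committed: there are matching `DepCommit`s of `2f+1` replicas. -/
  | fpCommit (i : Replica f) (s : Slot f) (Q : Finset (Replica f))
      (correct : i ∉ byz)
      (view : (σ.loc i s).view = -1) (phase : (σ.loc i s).phase = .fpVerified)
      (size : 2 * f + 1 ≤ Q.card)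
      (quorum : ∀ j ∈ Q, .depCommit ⟨s, j, h.verifies (σ.loc i s).verifies⟩ ∈ σ.sent) :
      Step h rule byz σ (σ.update i s
        { σ.loc i s with
          phase := .fpCommitted
          exec := some ((σ.loc i s).request,
            rule.result (σ.loc i s).propose (σ.loc i s).verifies) }
        ∅)
  /-- The fast path is impossible: the replica enters the reconciliation path in view `-1`. -/
  | rpVerify (i : Replica f) (s : Slot f) (dp : DepPropose f H)
      (correct : i ∉ byz)
      (view : (σ.loc i s).view = -1) (phase : (σ.loc i s).phase = .proposed)
      (propose : (σ.loc i s).propose = some dp)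
      (verified : Verified h σ s dp (σ.loc i s).verifies)
      (slow : ¬ FastDeps rule dp (σ.loc i s).verifies) :
      Step h rule byz σ (σ.update i s
        { σ.loc i s with phase := .rpVerified }
        {.prepare ⟨-1, s, i, h.verifies (σ.loc i s).verifies⟩})
  /-- The slot becomes rp-prepared in the current view. -/
  | rpPrepare (i : Replica f) (s : Slot f) (Q : Finset (Replica f))
      (correct : i ∉ byz) (phase : (σ.loc i s).phase = .rpVerified)
      (size : 2 * f + 1 ≤ Q.card)
      (quorum : ∀ j ∈ Q,
        .prepare ⟨(σ.loc i s).view, s, j, h.verifies (σ.loc i s).verifies⟩ ∈ σ.sent) :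
      Step h rule byz σ (σ.update i s
        { σ.loc i s with phase := .rpPrepared }
        {.commit ⟨(σ.loc i s).view, s, i, h.verifies (σ.loc i s).verifies⟩})
  /-- The slot becomes rp-committed in the current view. -/
  | rpCommit (i : Replica f) (s : Slot f) (Q : Finset (Replica f))
      (correct : i ∉ byz) (phase : (σ.loc i s).phase = .rpPrepared)
      (size : 2 * f + 1 ≤ Q.card)
      (quorum : ∀ j ∈ Q,
        .commit ⟨(σ.loc i s).view, s, j, h.verifies (σ.loc i s).verifies⟩ ∈ σ.sent) :
      Step h rule byz σ (σ.update i s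
        { σ.loc i s with
          phase := .rpCommitted
          exec := some ((σ.loc i s).request,
            rule.result (σ.loc i s).propose (σ.loc i s).verifies) }
        ∅)
  /-- A replica aborts its view of the slot and moves to a higher one, for whatever reason. -/
  | startViewChange (i : Replica f) (s : Slot f) (v : ℤ) (c : Option (Certificate f Req H))
      (correct : i ∉ byz) (higher : (σ.loc i s).view < v)
      (cert : UpdatedCert h σ s (σ.loc i s) c) :
      Step h rule byz σ (σ.update i s
        { σ.loc i s with view := v, phase := .viewChange, cert := c }
        {.viewChange ⟨v, s, i, c⟩})
  /-- The coordinator of a view sends a `NewView`. -/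
  | sendNewView (i : Replica f) (m : NewView f Req H)
      (correct : i ∉ byz) (sender : m.sender = i)
      (view : (σ.loc i m.slot).view = m.view) (phase : (σ.loc i m.slot).phase = .viewChange)
      (valid : ValidNewView h rule σ m) :
      Step h rule byz σ (σ.update i m.slot (σ.loc i m.slot) {.newView m})
  /-- A replica that waits for its new view accepts a correctly computed `NewView` and resumes with
  the reconciliation path. -/
  | acceptNewView (i : Replica f) (m : NewView f Req H)
      (correct : i ∉ byz) (sent : .newView m ∈ σ.sent)
      (view : (σ.loc i m.slot).view = m.view) (phase : (σ.loc i m.slot).phase = .viewChange)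
      (valid : ValidNewView h rule σ m) :
      Step h rule byz σ (σ.update i m.slot
        { σ.loc i m.slot with
          propose := m.proposal.map Prod.fst
          request := m.proposal.map Prod.snd
          verifies := m.verifies
          phase := .rpVerified }
        {.prepare ⟨m.view, m.slot, i, h.verifies m.verifies⟩})
  /-- A replica that has committed the slot reports the result. -/
  | sendExec (i : Replica f) (s : Slot f) (c : Option Req) (D : Finset (Slot f))
      (correct : i ∉ byz) (exec : (σ.loc i s).exec = some (c, D)) :
      Step h rule byz σ (σ.update i s (σ.loc i s) {.exec ⟨s, i, c, D⟩})
  /-- A replica commits a result that `f+1` replicas report. -/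
  | receiveExec (i : Replica f) (s : Slot f) (c : Option Req) (D : Finset (Slot f))
      (Q : Finset (Replica f))
      (correct : i ∉ byz) (size : f + 1 ≤ Q.card)
      (quorum : ∀ j ∈ Q, .exec ⟨s, j, c, D⟩ ∈ σ.sent) :
      Step h rule byz σ (σ.update i s { σ.loc i s with exec := some (c, D) } ∅)
  /-- A Byzantine replica sends an arbitrary message under its own signature. -/
  | byzantine (m : Msg f Req H) (faulty : m.signer ∈ byz) :
      Step h rule byz σ { σ with sent := insert m σ.sent }

/-- `σ'` is the state at the same or a later time of a run through `σ`. -/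
def Later {f : ℕ} {Req H : Type*} (h : Hash f Req H) (rule : DepRule)
    (byz : Finset (Replica f)) : State f Req H → State f Req H → Prop :=
  Relation.ReflTransGen (Step h rule byz)

end Isos

namespace Isos

variable {f : ℕ} {Req H : Type*}

/-! Any two sets of `2f+1` replicas share a correct one, so the proof rests on what a correct
replica can have signed. `LocalInv` records this for one slot: at most one DepPropose, one
DepVerify, one DepCommit hash and one Prepare hash per view; never both a DepCommit and a Prepare of
view `-1`; and ViewChanges that remember earlier votes. After a Commit of view `w`, a ViewChange for
a higher view carries an RPC of view at least `w`; after a DepCommit, it carries some FPC or RPC.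

`ExecInv` traces every committed result back to a quorum of DepCommits or Commits, because `f+1`
Execs include one from a correct replica. Given such a quorum, every valid NewView for a higher view
contains a ViewChange of a correct member. After a Commit quorum of view `v`, the selected RPC
therefore has view at least `v`. If its view is `v`, two Prepare quorums intersect and the hash is
the committed one; if it is higher, its Prepares were sent earlier, and induction on time applies
(`preparesAgree_of_newView`).

After a DepCommit quorum there is no RPC of view `-1`, and one of a later view is treated as before.
Otherwise an FPC is selected, possibly with other DepVerifys than the committed ones, since
Byzantine replicas may sign several. Agreement is therefore tracked on outcomes, not on hashes: only
one DepPropose can be verified (`Inv.propose_eq_of_verified`), and a dependency reported `f+1` times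
comes from a correct replica whose only DepVerify is in every verified set
(`Inv.result_subset_of_fastDeps`).

For `f ≥ 1` a hash of DepVerifys determines the outcome. For `f = 0` all these sets are empty and
the hash says nothing; there the state of the only replica fixes the content (`SlotState.Settled`).
-/

/-- The slot that a message is about. -/
def Msg.slot : Msg f Req H → Slot f
  | .depPropose m => m.slot
  | .depVerify m => m.slot
  | .depCommit m => m.slot
  | .prepare m => m.slot
  | .commit m => m.slot
  | .viewChange m => m.slot
  | .newView m => m.slot
  | .exec m => m.slot

/-! ### The local invariant of a correct replica -/

/-- The slot is fp-verified in the current view. -/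
def Phase.IsFast (p : Phase) : Prop := p = .fpVerified ∨ p = .fpCommitted

/-- The slot is rp-prepared in the current view. -/
def Phase.IsPrepared (p : Phase) : Prop := p = .rpPrepared ∨ p = .rpCommitted

/-- The slot is on the reconciliation path of the current view. -/
def Phase.IsRecon (p : Phase) : Prop := p = .rpVerified ∨ p = .rpPrepared ∨ p = .rpCommitted

/-- Content that a replica may agree on: a verified proposal with its request, or the no-op. -/
def ValidContent (h : Hash f Req H) (σ : State f Req H) (s : Slot f) :
    Proposal f Req H → Finset (DepVerify f H) → Prop
  | some (dp, r), dv => Verified h σ s dp dv ∧ h.request r = dp.reqHash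
  | none, dv => dv = ∅

/-- The certificate preserves a `DepCommit` with hash `x`. -/
def KeepsDepCommit (h : Hash f Req H) (x : H) (c : Option (Certificate f Req H)) : Prop :=
  (∃ dp r dv, c = some (.fpc dp r dv) ∧ h.verifies dv = x) ∨
    ∃ p dv prep w, c = some (.rpc p dv prep w)

/-- The certificate is a reconciliation-path certificate of view at least `w`. -/
def KeepsCommit (w : ℤ) (c : Option (Certificate f Req H)) : Prop :=
  ∃ p dv prep w', c = some (.rpc p dv prep w') ∧ w ≤ w'

theorem ValidPropose.mono {σ σ' : State f Req H} (hs : σ.sent ⊆ σ'.sent) {s : Slot f}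
    {dp : DepPropose f H} (hv : ValidPropose σ s dp) : ValidPropose σ' s dp :=
  ⟨hs hv.1, hv.2⟩

theorem Verified.mono {h : Hash f Req H} {σ σ' : State f Req H} (hs : σ.sent ⊆ σ'.sent)
    {s : Slot f} {dp : DepPropose f H} {dv : Finset (DepVerify f H)}
    (hv : Verified h σ s dp dv) : Verified h σ' s dp dv :=
  ⟨hv.1.mono hs, hv.2.1, hv.2.2.1, fun m hm => ⟨hs (hv.2.2.2 m hm).1, (hv.2.2.2 m hm).2⟩⟩

theorem ValidContent.mono {h : Hash f Req H} {σ σ' : State f Req H} (hs : σ.sent ⊆ σ'.sent)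
    {s : Slot f} {p : Proposal f Req H} {dv : Finset (DepVerify f H)}
    (hv : ValidContent h σ s p dv) : ValidContent h σ' s p dv := by
  rcases p with _ | ⟨dp, r⟩
  · exact hv
  · exact ⟨hv.1.mono hs, hv.2⟩

/-- The invariant of a correct replica `i` with local state `l` for slot `s`. -/
structure LocalInv (h : Hash f Req H) (rule : DepRule) (σ : State f Req H) (i : Replica f)
    (s : Slot f) (l : SlotState f Req H) : Prop where
  view_ge : -1 ≤ l.view
  viewChange_view : l.phase = .viewChange → 0 ≤ l.view
  init_propose : l.phase = .init → ∀ dp, .depPropose dp ∈ σ.sent → dp.sender = i → dp.slot = s → False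
  init_verify : l.phase = .init → ∀ m, .depVerify m ∈ σ.sent → m.sender = i → m.slot = s → False
  propose_unique : ∀ dp dp', .depPropose dp ∈ σ.sent → .depPropose dp' ∈ σ.sent →
    dp.sender = i → dp.slot = s → dp'.sender = i → dp'.slot = s → dp = dp'
  verify_unique : ∀ m m', .depVerify m ∈ σ.sent → .depVerify m' ∈ σ.sent →
    m.sender = i → m.slot = s → m'.sender = i → m'.slot = s → m = m'
  proposed : l.phase = .proposed →
    ∃ dp r, l.propose = some dp ∧ l.request = some r ∧ h.request r = dp.reqHash
  fast : l.phase.IsFast → l.view = -1 ∧ ∃ dp r, l.propose = some dp ∧ l.request = some r ∧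
    h.request r = dp.reqHash ∧ Verified h σ s dp l.verifies ∧ FastDeps rule dp l.verifies
  recon : l.phase.IsRecon → ∃ p : Proposal f Req H, l.propose = p.map Prod.fst ∧
    l.request = p.map Prod.snd ∧ ValidContent h σ s p l.verifies
  depCommit_state : ∀ x, .depCommit ⟨s, i, x⟩ ∈ σ.sent →
    (l.phase.IsFast ∧ x = h.verifies l.verifies) ∨ (0 ≤ l.view ∧ KeepsDepCommit h x l.cert)
  depCommit_unique : ∀ x x', .depCommit ⟨s, i, x⟩ ∈ σ.sent → .depCommit ⟨s, i, x'⟩ ∈ σ.sent → x = x'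
  depCommit_prepare : ∀ x x', .depCommit ⟨s, i, x⟩ ∈ σ.sent → .prepare ⟨-1, s, i, x'⟩ ∈ σ.sent → False
  prepare_state : ∀ w x, .prepare ⟨w, s, i, x⟩ ∈ σ.sent → -1 ≤ w ∧ w ≤ l.view ∧
    (w = l.view → l.phase.IsRecon ∧ x = h.verifies l.verifies)
  prepare_unique : ∀ w x x', .prepare ⟨w, s, i, x⟩ ∈ σ.sent → .prepare ⟨w, s, i, x'⟩ ∈ σ.sent → x = x'
  commit_state : ∀ w x, .commit ⟨w, s, i, x⟩ ∈ σ.sent → -1 ≤ w ∧ w ≤ l.view ∧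
    (w = l.view → l.phase.IsPrepared) ∧ (w < l.view → KeepsCommit w l.cert)
  commit_quorum : ∀ w x, .commit ⟨w, s, i, x⟩ ∈ σ.sent →
    ∃ Q : Finset (Replica f), 2 * f + 1 ≤ Q.card ∧ ∀ j ∈ Q, .prepare ⟨w, s, j, x⟩ ∈ σ.sent
  viewChange_state : ∀ v c, .viewChange ⟨v, s, i, c⟩ ∈ σ.sent →
    0 ≤ v ∧ v ≤ l.view ∧ (v = l.view → c = l.cert)
  viewChange_commit : ∀ v c w x, .viewChange ⟨v, s, i, c⟩ ∈ σ.sent →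
    .commit ⟨w, s, i, x⟩ ∈ σ.sent → w < v → KeepsCommit w c
  viewChange_depCommit : ∀ v c x, .viewChange ⟨v, s, i, c⟩ ∈ σ.sent →
    .depCommit ⟨s, i, x⟩ ∈ σ.sent → KeepsDepCommit h x c

/-- The local invariant survives the steps of other replicas and steps in other slots. -/
theorem LocalInv.frame {h : Hash f Req H} {rule : DepRule} {σ σ' : State f Req H} {i : Replica f}
    {s : Slot f} {l : SlotState f Req H} (inv : LocalInv h rule σ i s l) (hs : σ.sent ⊆ σ'.sent)
    (own : ∀ m ∈ σ'.sent, m.signer = i → m.slot = s → m ∈ σ.sent) : LocalInv h rule σ' i s l where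
  view_ge := inv.view_ge
  viewChange_view := inv.viewChange_view
  init_propose hp dp hdp e₁ e₂ := inv.init_propose hp dp (own _ hdp e₁ e₂) e₁ e₂
  init_verify hp m hm e₁ e₂ := inv.init_verify hp m (own _ hm e₁ e₂) e₁ e₂
  propose_unique dp dp' hdp hdp' e₁ e₂ e₃ e₄ :=
    inv.propose_unique dp dp' (own _ hdp e₁ e₂) (own _ hdp' e₃ e₄) e₁ e₂ e₃ e₄
  verify_unique dp dp' hdp hdp' e₁ e₂ e₃ e₄ :=
    inv.verify_unique dp dp' (own _ hdp e₁ e₂) (own _ hdp' e₃ e₄) e₁ e₂ e₃ e₄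
  proposed := inv.proposed
  fast hp := by
    obtain ⟨hv, dp, r, h₁, h₂, h₃, h₄, h₅⟩ := inv.fast hp
    exact ⟨hv, dp, r, h₁, h₂, h₃, h₄.mono hs, h₅⟩
  recon hp := by
    obtain ⟨p, h₁, h₂, h₃⟩ := inv.recon hp
    exact ⟨p, h₁, h₂, h₃.mono hs⟩
  depCommit_state x hx := inv.depCommit_state x (own _ hx rfl rfl)
  depCommit_unique x x' hx hx' := inv.depCommit_unique x x' (own _ hx rfl rfl) (own _ hx' rfl rfl)
  depCommit_prepare x x' hx hx' := inv.depCommit_prepare x x' (own _ hx rfl rfl) (own _ hx' rfl rfl)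
  prepare_state w x hx := inv.prepare_state w x (own _ hx rfl rfl)
  prepare_unique w x x' hx hx' := inv.prepare_unique w x x' (own _ hx rfl rfl) (own _ hx' rfl rfl)
  commit_state w x hx := inv.commit_state w x (own _ hx rfl rfl)
  commit_quorum w x hx := by
    obtain ⟨Q, hQ, hp⟩ := inv.commit_quorum w x (own _ hx rfl rfl)
    exact ⟨Q, hQ, fun j hj => hs (hp j hj)⟩
  viewChange_state v c hm := inv.viewChange_state v c (own _ hm rfl rfl)
  viewChange_commit v c w x hm hx :=
    inv.viewChange_commit v c w x (own _ hm rfl rfl) (own _ hx rfl rfl)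
  viewChange_depCommit v c x hm hx :=
    inv.viewChange_depCommit v c x (own _ hm rfl rfl) (own _ hx rfl rfl)

/-! ### Preservation of the invariant by every step -/

theorem State.sent_subset_update (σ : State f Req H) (i : Replica f) (s : Slot f)
    (l : SlotState f Req H) (ms : Set (Msg f Req H)) : σ.sent ⊆ (σ.update i s l ms).sent :=
  Set.subset_union_left

theorem Step.sent_subset {h : Hash f Req H} {rule : DepRule} {byz : Finset (Replica f)}
    {σ σ' : State f Req H} (st : Step h rule byz σ σ') : σ.sent ⊆ σ'.sent := by
  cases st
  case byzantine => exact Set.subset_insert _ _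
  all_goals exact Set.subset_union_left

theorem State.update_loc_self (σ : State f Req H) (i : Replica f) (s : Slot f)
    (l : SlotState f Req H) (ms : Set (Msg f Req H)) : (σ.update i s l ms).loc i s = l := by
  simp [State.update]

theorem State.update_loc_of_ne (σ : State f Req H) {i i' : Replica f} {s s' : Slot f}
    (l : SlotState f Req H) (ms : Set (Msg f Req H)) (hne : ¬ (i' = i ∧ s' = s)) :
    (σ.update i s l ms).loc i' s' = σ.loc i' s' := by
  by_cases hi : i' = i
  · subst hi
    simp only [State.update, Function.update_self]
    exact Function.update_of_ne (fun e => hne ⟨rfl, e⟩) _ _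
  · simp [State.update, Function.update_of_ne hi]

/-- The local invariant holds at every correct replica, for every slot. -/
def Inv (h : Hash f Req H) (rule : DepRule) (byz : Finset (Replica f)) (σ : State f Req H) : Prop :=
  ∀ i ∉ byz, ∀ s, LocalInv h rule σ i s (σ.loc i s)

theorem Inv.initial (h : Hash f Req H) (rule : DepRule) (byz : Finset (Replica f)) :
    Inv h rule byz (State.initial f Req H) := by
  intro i _ s
  constructor <;> simp [State.initial, SlotState.initial, Phase.IsFast, Phase.IsRecon]

theorem State.mem_update_sent {σ : State f Req H} {i : Replica f} {s : Slot f}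
    {l : SlotState f Req H} {ms : Set (Msg f Req H)} {m : Msg f Req H} :
    m ∈ (σ.update i s l ms).sent ↔ m ∈ σ.sent ∨ m ∈ ms :=
  Iff.rfl

/-- Reduces a step to the acting replica in its own slot: elsewhere neither the local state nor the
own messages change, so `LocalInv.frame` applies. -/
theorem Inv.update {h : Hash f Req H} {rule : DepRule} {byz : Finset (Replica f)}
    {σ : State f Req H} (inv : Inv h rule byz σ) {i : Replica f} {s : Slot f} (hi : i ∉ byz)
    {l : SlotState f Req H} {ms : Set (Msg f Req H)} (hms : ∀ m ∈ ms, m.signer = i ∧ m.slot = s)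
    (hl : LocalInv h rule σ i s (σ.loc i s) → LocalInv h rule (σ.update i s l ms) i s l) :
    Inv h rule byz (σ.update i s l ms) := by
  intro i' hi' s'
  by_cases e : i' = i ∧ s' = s
  · obtain ⟨rfl, rfl⟩ := e
    rw [State.update_loc_self]
    exact hl (inv i' hi s')
  · rw [State.update_loc_of_ne _ _ _ e]
    refine (inv i' hi' s').frame (State.sent_subset_update ..) ?_
    rintro m (hm | hm) h₁ h₂
    · exact hm
    · exact absurd ⟨h₁.symm.trans (hms m hm).1, h₂.symm.trans (hms m hm).2⟩ e

/-- A selected certificate is itself valid, and its validity includes the checks on its content; the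
no-op needs none. -/
theorem ValidNewView.validContent {h : Hash f Req H} {rule : DepRule} {σ : State f Req H}
    {m : NewView f Req H} (hm : ValidNewView h rule σ m) :
    ValidContent h σ m.slot m.proposal m.verifies := by
  obtain ⟨_, _, _, hvc, hsel⟩ := hm
  rcases hsel with ⟨m', hm', prep, w, hc, _⟩ | ⟨_, m', hm', dp, r, hc, hp⟩ | ⟨_, hp, hdv⟩
  · have := (hvc m' hm').2.2.2 _ hc
    revert this
    rcases m.proposal with _ | ⟨dp, r⟩
    · exact fun this => this.1
    · exact fun this => ⟨this.1, this.2.1⟩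
  · have := (hvc m' hm').2.2.2 _ hc
    rw [hp]
    exact ⟨this.1, this.2.1⟩
  · rw [hp]
    exact hdv

/-- A Commit of the current view means that the slot is rp-prepared, so the new certificate is an
RPC of this view. For a Commit of a lower view, the old certificate suffices or is replaced by an
RPC of the current view; an FPC cannot replace it, because the fast phases occur only in view `-1`.
-/
theorem LocalInv.keepsCommit {h : Hash f Req H} {rule : DepRule} {σ : State f Req H}
    {i : Replica f} {s : Slot f} {l : SlotState f Req H} (inv : LocalInv h rule σ i s l)
    {c : Option (Certificate f Req H)} (hc : UpdatedCert h σ s l c) {w : ℤ} {x : H}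
    (hw : .commit ⟨w, s, i, x⟩ ∈ σ.sent) : KeepsCommit w c := by
  obtain ⟨hge, hle, heq, hlt⟩ := inv.commit_state w x hw
  have hfast := inv.fast
  unfold UpdatedCert at hc
  unfold KeepsCommit at *
  rcases hle.eq_or_lt with e | e <;> cases hp : l.phase <;>
    grind [Phase.IsPrepared, Phase.IsFast]

/-- Still in a fast phase, the replica reports its own FPC. In a view `≥ 0` only an RPC can displace
the stored certificate. -/
theorem LocalInv.keepsDepCommit {h : Hash f Req H} {rule : DepRule} {σ : State f Req H}
    {i : Replica f} {s : Slot f} {l : SlotState f Req H} (inv : LocalInv h rule σ i s l)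
    {c : Option (Certificate f Req H)} (hc : UpdatedCert h σ s l c) {x : H}
    (hx : .depCommit ⟨s, i, x⟩ ∈ σ.sent) : KeepsDepCommit h x c := by
  have hst := inv.depCommit_state x hx
  have hfast := inv.fast
  unfold UpdatedCert at hc
  unfold KeepsDepCommit at *
  cases hp : l.phase <;> grind [Phase.IsFast]

set_option maxHeartbeats 4000000 in
theorem Inv.step {h : Hash f Req H} {rule : DepRule} {byz : Finset (Replica f)}
    {σ σ' : State f Req H} (inv : Inv h rule byz σ) (st : Step h rule byz σ σ') :
    Inv h rule byz σ' := by
  -- Valid content stays valid as messages accumulate; these facts carry the fields `fast` and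
  -- `recon` over to `σ'`.
  have hV : ∀ s dp dv, Verified h σ s dp dv → Verified h σ' s dp dv :=
    fun s dp dv hv => hv.mono st.sent_subset
  have hC : ∀ s p dv, ValidContent h σ s p dv → ValidContent h σ' s p dv :=
    fun s p dv hv => hv.mono st.sent_subset
  have hD : ∀ s dp r dv, Verified h σ s dp dv → h.request r = dp.reqHash →
      ValidContent h σ' s (some (dp, r)) dv := fun s dp r dv hv hr => hC s (some (dp, r)) dv ⟨hv, hr⟩
  have hN : ∀ m, ValidNewView h rule σ m → ValidContent h σ' m.slot m.proposal m.verifies :=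
    fun m hm => hC _ _ _ hm.validContent
  cases st
  case byzantine m faulty =>
    intro i hi s
    refine (inv i hi s).frame (Set.subset_insert _ _) ?_
    rintro m' (rfl | hm) h₁ h₂
    · exact absurd (h₁ ▸ faulty) hi
    · exact hm
  all_goals
    refine inv.update (by assumption) (by simp +contextual [Msg.signer, Msg.slot, *]) fun I => ?_
    -- These two serve the ViewChange sent on leaving a view, whose certificate is computed from the
    -- old local state.
    have hU₁ := fun c hc w x => I.keepsCommit (c := c) hc (w := w) (x := x)
    have hU₂ := fun c hc x => I.keepsDepCommit (c := c) hc (x := x)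
    obtain ⟨_, _, _, _, _, _, _, _, _, _, _, _, _, _, _, _, _, _, _⟩ := I
    constructor <;>
      try simp only [State.mem_update_sent, Set.mem_singleton_iff, Set.mem_ofPred_eq,
        Set.mem_empty_iff_false, reduceCtorEq, and_false, or_false]
    all_goals grind [Phase.IsFast, Phase.IsRecon, Phase.IsPrepared]

theorem Later.inv {h : Hash f Req H} {rule : DepRule} {byz : Finset (Replica f)}
    {σ : State f Req H} (hσ : Later h rule byz (State.initial f Req H) σ) :
    Inv h rule byz σ := by
  induction hσ with
  | refl => exact Inv.initial h rule byz
  | tail _ st ih => exact ih.step st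

theorem Later.sent_subset {h : Hash f Req H} {rule : DepRule} {byz : Finset (Replica f)}
    {σ σ' : State f Req H} (hσ : Later h rule byz σ σ') : σ.sent ⊆ σ'.sent := by
  induction hσ with
  | refl => exact subset_rfl
  | tail _ st ih => exact ih.trans st.sent_subset

/-! ### Commits and the messages that justify them -/

/-- The request and dependency set that result from committing the given content. -/
def outcome (rule : DepRule) (p : Proposal f Req H) (dv : Finset (DepVerify f H)) :
    Option Req × Finset (Slot f) :=
  (p.map Prod.snd, rule.result (p.map Prod.fst) dv)

/-- There are `DepCommit`s with hash `x` of `2f+1` replicas. -/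
def DepCommitQuorum (σ : State f Req H) (s : Slot f) (x : H) : Prop :=
  ∃ Q : Finset (Replica f), 2 * f + 1 ≤ Q.card ∧ ∀ j ∈ Q, .depCommit ⟨s, j, x⟩ ∈ σ.sent

/-- There are `Prepare`s of view `v` with hash `x` of `2f+1` replicas. -/
def PreparedBy (σ : State f Req H) (s : Slot f) (v : ℤ) (x : H) : Prop :=
  ∃ Q : Finset (Replica f), 2 * f + 1 ≤ Q.card ∧ ∀ j ∈ Q, .prepare ⟨v, s, j, x⟩ ∈ σ.sent

/-- There are `Commit`s of view `v` with hash `x` of `2f+1` replicas. -/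
def CommitQuorum (σ : State f Req H) (s : Slot f) (v : ℤ) (x : H) : Prop :=
  ∃ Q : Finset (Replica f), 2 * f + 1 ≤ Q.card ∧ ∀ j ∈ Q, .commit ⟨v, s, j, x⟩ ∈ σ.sent

/-- The messages sent so far justify a commit of `R` on the fast or the reconciliation path. -/
def Committed (h : Hash f Req H) (rule : DepRule) (σ : State f Req H) (s : Slot f)
    (R : Option Req × Finset (Slot f)) : Prop :=
  ∃ p dv, ValidContent h σ s p dv ∧ outcome rule p dv = R ∧
    ((DepCommitQuorum σ s (h.verifies dv) ∧ ∃ dp r, p = some (dp, r) ∧ FastDeps rule dp dv) ∨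
      ∃ v, CommitQuorum σ s v (h.verifies dv))

theorem Committed.mono {h : Hash f Req H} {rule : DepRule} {σ σ' : State f Req H}
    (hs : σ.sent ⊆ σ'.sent) {s : Slot f} {R : Option Req × Finset (Slot f)}
    (hc : Committed h rule σ s R) : Committed h rule σ' s R := by
  obtain ⟨p, dv, hv, hR, ⟨⟨Q, hQ, hm⟩, hf⟩ | ⟨v, Q, hQ, hm⟩⟩ := hc
  · exact ⟨p, dv, hv.mono hs, hR, .inl ⟨⟨Q, hQ, fun j hj => hs (hm j hj)⟩, hf⟩⟩
  · exact ⟨p, dv, hv.mono hs, hR, .inr ⟨v, Q, hQ, fun j hj => hs (hm j hj)⟩⟩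

/-- Two quorums of `2f+1` replicas share a correct one. -/
theorem exists_correct_of_quorums {byz : Finset (Replica f)} (hbyz : byz.card ≤ f)
    {Q Q' : Finset (Replica f)} (hQ : 2 * f + 1 ≤ Q.card) (hQ' : 2 * f + 1 ≤ Q'.card) :
    ∃ j ∉ byz, j ∈ Q ∧ j ∈ Q' := by
  have h₁ := Finset.card_union_add_card_inter Q Q'
  have h₂ : (Q ∪ Q').card ≤ 3 * f + 1 := by simpa using Finset.card_le_univ (Q ∪ Q')
  obtain ⟨j, hj, hjb⟩ : ∃ j ∈ Q ∩ Q', j ∉ byz :=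
    Finset.exists_mem_notMem_of_card_lt_card (by omega)
  exact ⟨j, hjb, by simpa using hj⟩

/-- A set of more than `f` replicas contains a correct one. -/
theorem exists_correct {byz : Finset (Replica f)} (hbyz : byz.card ≤ f)
    {Q : Finset (Replica f)} (hQ : f + 1 ≤ Q.card) : ∃ j ∈ Q, j ∉ byz :=
  Finset.exists_mem_notMem_of_card_lt_card (by omega)

/-- Results committed or reported by correct replicas are justified by the messages sent. -/
def ExecInv (h : Hash f Req H) (rule : DepRule) (byz : Finset (Replica f))
    (σ : State f Req H) : Prop :=
  ∀ i ∉ byz, ∀ s c D, ((σ.loc i s).exec = some (c, D) ∨ .exec ⟨s, i, c, D⟩ ∈ σ.sent) →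
    Committed h rule σ s (c, D)

theorem ExecInv.update {h : Hash f Req H} {rule : DepRule} {byz : Finset (Replica f)}
    {σ : State f Req H} (ex : ExecInv h rule byz σ) {i : Replica f} {s : Slot f}
    {l : SlotState f Req H} {ms : Set (Msg f Req H)}
    (hl : ∀ R, l.exec = some R → (σ.loc i s).exec = some R ∨
      Committed h rule (σ.update i s l ms) s R)
    (hms : ∀ m, .exec m ∈ ms → m.slot = s ∧ m.sender = i ∧
      (σ.loc i s).exec = some (m.request, m.deps)) (hi : i ∉ byz) :
    ExecInv h rule byz (σ.update i s l ms) := by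
  have hs := State.sent_subset_update σ i s l ms
  rintro i' hi' s' c D (he | hm | hm)
  · by_cases e : i' = i ∧ s' = s
    · obtain ⟨rfl, rfl⟩ := e
      rw [State.update_loc_self] at he
      rcases hl _ he with h₁ | h₁
      · exact (ex i' hi' s' c D (.inl h₁)).mono hs
      · exact h₁
    · rw [State.update_loc_of_ne _ _ _ e] at he
      exact (ex i' hi' s' c D (.inl he)).mono hs
  · exact (ex i' hi' s' c D (.inr hm)).mono hs
  · obtain ⟨rfl, rfl, h₃⟩ := hms _ hm
    exact (ex _ hi _ c D (.inl h₃)).mono hs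

theorem ExecInv.step {h : Hash f Req H} {rule : DepRule} {byz : Finset (Replica f)}
    (hbyz : byz.card ≤ f) {σ σ' : State f Req H} (inv : Inv h rule byz σ)
    (ex : ExecInv h rule byz σ) (st : Step h rule byz σ σ') : ExecInv h rule byz σ' := by
  have hs := st.sent_subset
  cases st
  case byzantine m faulty =>
    rintro i hi s c D (he | rfl | hm)
    · exact (ex i hi s c D (.inl he)).mono hs
    · exact absurd faulty hi
    · exact (ex i hi s c D (.inr hm)).mono hs
  case sendExec i s c D correct exec =>
    refine ex.update (fun R hR => .inl hR) ?_ correct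
    rintro m hm
    cases hm
    exact ⟨rfl, rfl, exec⟩
  case receiveExec i s c D Q correct size quorum =>
    refine ex.update (fun R hR => .inr ?_) (by simp) correct
    cases hR
    -- One of the `f+1` reporters is correct, and its report is already justified.
    obtain ⟨j, hj, hjb⟩ := exists_correct hbyz size
    exact (ex j hjb s c D (.inr (quorum j hj))).mono hs
  case fpCommit i s Q correct view phase size quorum =>
    refine ex.update (fun R hR => .inr ?_) (by simp) correct
    cases hR
    obtain ⟨_, dp, r, h₁, h₂, h₃, h₄, h₅⟩ := (inv i correct s).fast (.inl phase)
    refine Committed.mono hs ⟨some (dp, r), (σ.loc i s).verifies, ⟨h₄, h₃⟩, ?_,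
      .inl ⟨⟨Q, size, quorum⟩, dp, r, rfl, h₅⟩⟩
    simp [outcome, h₁, h₂]
  case rpCommit i s Q correct phase size quorum =>
    refine ex.update (fun R hR => .inr ?_) (by simp) correct
    cases hR
    obtain ⟨p, h₁, h₂, h₃⟩ := (inv i correct s).recon (.inr (.inl phase))
    refine Committed.mono hs ⟨p, (σ.loc i s).verifies, h₃, ?_, .inr ⟨_, Q, size, quorum⟩⟩
    simp [outcome, h₁, h₂]
  all_goals exact ex.update (fun R hR => .inl hR) (by simp) (by assumption)

theorem Later.execInv {h : Hash f Req H} {rule : DepRule} {byz : Finset (Replica f)}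
    (hbyz : byz.card ≤ f) {σ : State f Req H} (hσ : Later h rule byz (State.initial f Req H) σ) :
    ExecInv h rule byz σ := by
  induction hσ with
  | refl => intro i _ s c D; simp [State.initial, SlotState.initial]
  | tail hσ st ih => exact ih.step hbyz (Later.inv hσ) st

/-! ### Quorum intersection -/

section quorums

variable {h : Hash f Req H} {rule : DepRule} {byz : Finset (Replica f)} {σ : State f Req H}
  {s : Slot f}

theorem Inv.preparedBy_unique (inv : Inv h rule byz σ) (hbyz : byz.card ≤ f) {v : ℤ} {x x' : H}
    (hx : PreparedBy σ s v x) (hx' : PreparedBy σ s v x') : x = x' := by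
  obtain ⟨Q, hQ, hm⟩ := hx
  obtain ⟨Q', hQ', hm'⟩ := hx'
  obtain ⟨j, hj, h₁, h₂⟩ := exists_correct_of_quorums hbyz hQ hQ'
  exact (inv j hj s).prepare_unique v x x' (hm j h₁) (hm' j h₂)

theorem Inv.depCommitQuorum_unique (inv : Inv h rule byz σ) (hbyz : byz.card ≤ f) {x x' : H}
    (hx : DepCommitQuorum σ s x) (hx' : DepCommitQuorum σ s x') : x = x' := by
  obtain ⟨Q, hQ, hm⟩ := hx
  obtain ⟨Q', hQ', hm'⟩ := hx'
  obtain ⟨j, hj, h₁, h₂⟩ := exists_correct_of_quorums hbyz hQ hQ'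
  exact (inv j hj s).depCommit_unique x x' (hm j h₁) (hm' j h₂)

/-- The fast path and the reconciliation path of view `-1` exclude each other. -/
theorem Inv.not_preparedBy_of_depCommitQuorum (inv : Inv h rule byz σ) (hbyz : byz.card ≤ f)
    {x x' : H} (hx : DepCommitQuorum σ s x) : ¬ PreparedBy σ s (-1) x' := by
  rintro ⟨Q', hQ', hm'⟩
  obtain ⟨Q, hQ, hm⟩ := hx
  obtain ⟨j, hj, h₁, h₂⟩ := exists_correct_of_quorums hbyz hQ hQ'
  exact (inv j hj s).depCommit_prepare x x' (hm j h₁) (hm' j h₂)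

theorem PreparedBy.exists_correct (hbyz : byz.card ≤ f) {v : ℤ} {x : H}
    (hx : PreparedBy σ s v x) : ∃ j ∉ byz, .prepare ⟨v, s, j, x⟩ ∈ σ.sent := by
  obtain ⟨Q, hQ, hm⟩ := hx
  obtain ⟨j, hj, hjb⟩ := Isos.exists_correct hbyz (Q := Q) (by omega)
  exact ⟨j, hjb, hm j hj⟩

theorem Inv.preparedBy_of_commitQuorum (inv : Inv h rule byz σ) (hbyz : byz.card ≤ f) {v : ℤ}
    {x : H} (hx : CommitQuorum σ s v x) : PreparedBy σ s v x := by
  obtain ⟨Q, hQ, hm⟩ := hx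
  obtain ⟨j, hj, hjb⟩ := exists_correct hbyz (Q := Q) (by omega)
  exact (inv j hjb s).commit_quorum v x (hm j hj)

theorem PrepareQuorum.preparedBy {v : ℤ} {x : H} {prep : Finset (Prepare f H)}
    (hp : PrepareQuorum σ s v x prep) : PreparedBy σ s v x := by
  classical
  refine ⟨prep.image Prepare.sender, ?_, ?_⟩
  · rw [Finset.card_image_of_injOn hp.2.1]
    exact hp.1
  · intro j hj
    obtain ⟨m, hm, rfl⟩ := Finset.mem_image.1 hj
    obtain ⟨h₁, rfl, rfl, rfl⟩ := hp.2.2 m hm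
    exact h₁

theorem PreparedBy.mono {σ' : State f Req H} (hs : σ.sent ⊆ σ'.sent) {v : ℤ} {x : H}
    (hx : PreparedBy σ s v x) : PreparedBy σ' s v x := by
  obtain ⟨Q, hQ, hm⟩ := hx
  exact ⟨Q, hQ, fun j hj => hs (hm j hj)⟩

theorem ValidCert.preparedBy {p : Proposal f Req H} {dv : Finset (DepVerify f H)}
    {prep : Finset (Prepare f H)} {w : ℤ} (hc : ValidCert h rule σ s (.rpc p dv prep w)) :
    PreparedBy σ s w (h.verifies dv) := by
  rcases p with _ | ⟨dp, r⟩
  · exact hc.2.preparedBy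
  · exact hc.2.2.preparedBy

/-- The `ViewChange`s of a valid `NewView` include one of a correct member of any quorum. -/
theorem ValidNewView.exists_correct {m : NewView f Req H} (hm : ValidNewView h rule σ m)
    (hbyz : byz.card ≤ f) {Q : Finset (Replica f)} (hQ : 2 * f + 1 ≤ Q.card) :
    ∃ j ∉ byz, j ∈ Q ∧ ∃ c, ⟨m.view, m.slot, j, c⟩ ∈ m.vcs ∧
      .viewChange ⟨m.view, m.slot, j, c⟩ ∈ σ.sent := by
  classical
  obtain ⟨_, hcard, hinj, hvc, _⟩ := hm
  rw [← Finset.card_image_of_injOn hinj] at hcard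
  obtain ⟨j, hj, h₁, h₂⟩ := exists_correct_of_quorums hbyz hQ hcard
  obtain ⟨⟨v, s, _, c⟩, hc, rfl⟩ := Finset.mem_image.1 h₂
  obtain ⟨h₃, rfl, rfl, _⟩ := hvc _ hc
  exact ⟨_, hj, h₁, c, hc, h₃⟩

end quorums

/-! ### Verified proposals and their dependency sets -/

section verified

variable {h : Hash f Req H} {rule : DepRule} {byz : Finset (Replica f)} {σ : State f Req H}
  {s : Slot f}

/-- Every member of the fast-path quorum contributes to the `DepVerify`s. -/
theorem Verified.exists_sender {dp : DepPropose f H} {dv : Finset (DepVerify f H)}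
    (hv : Verified h σ s dp dv) {j : Replica f} (hj : j ∈ dp.quorum) : ∃ m ∈ dv, m.sender = j := by
  classical
  obtain ⟨⟨_, _, _, _, hF⟩, hcard, hinj, hm⟩ := hv
  have hsub : dv.image DepVerify.sender ⊆ dp.quorum := by
    intro k hk
    obtain ⟨m, hm', rfl⟩ := Finset.mem_image.1 hk
    exact (hm m hm').2.2.1
  -- The `2f` different senders exhaust a quorum of size `2f`.
  have := Finset.eq_of_subset_of_card_le hsub
    (by rw [Finset.card_image_of_injOn hinj, hF, hcard])
  rw [← this] at hj
  exact Finset.mem_image.1 hj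

/-- At most one `DepPropose` of a slot can be verified. -/
theorem Inv.propose_eq_of_verified (inv : Inv h rule byz σ) (hh : h.CollisionFree)
    (hbyz : byz.card ≤ f) {dp dp' : DepPropose f H} {dv dv' : Finset (DepVerify f H)}
    (hv : Verified h σ s dp dv) (hv' : Verified h σ s dp' dv') : dp = dp' := by
  classical
  obtain ⟨h₁, h₂, h₃, h₄, h₅⟩ := hv.1
  obtain ⟨g₁, g₂, g₃, g₄, g₅⟩ := hv'.1
  by_cases hs : s.1 ∈ byz
  -- Two sets of `2f` among the `3f` followers share at least `f`. The coordinator being Byzantine,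
  -- at most `f-1` followers are, so a common member is correct, and its only DepVerify names both
  -- proposals.
  · have hsub : dp.quorum ∪ dp'.quorum ⊆ Finset.univ.erase s.1 := by
      intro k hk
      refine Finset.mem_erase.2 ⟨?_, Finset.mem_univ _⟩
      rintro rfl
      simp_all
    have hcard := Finset.card_le_card hsub
    have := Finset.card_union_add_card_inter dp.quorum dp'.quorum
    have hb := Finset.card_erase_add_one hs
    rw [Finset.card_erase_of_mem (Finset.mem_univ _), Finset.card_univ, Fintype.card_fin] at hcard
    obtain ⟨j, hj, hjb⟩ : ∃ j ∈ dp.quorum ∩ dp'.quorum, j ∉ byz.erase s.1 :=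
      Finset.exists_mem_notMem_of_card_lt_card (by omega)
    rw [Finset.mem_inter] at hj
    have hjb : j ∉ byz := fun hb => hjb (Finset.mem_erase.2 ⟨by rintro rfl; exact h₄ hj.1, hb⟩)
    obtain ⟨m, hm, e⟩ := hv.exists_sender hj.1
    obtain ⟨m', hm', e'⟩ := hv'.exists_sender hj.2
    obtain ⟨k₁, k₂, _, k₄⟩ := hv.2.2.2 m hm
    obtain ⟨k₁', k₂', _, k₄'⟩ := hv'.2.2.2 m' hm'
    have := (inv j hjb s).verify_unique m m' k₁ k₁' e k₂ e' k₂'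
    subst this
    exact hh.2.1 (k₄.symm.trans k₄')
  · exact (inv s.1 hs s).propose_unique dp dp' h₁ g₁ h₃ h₂ g₃ g₂

/-- On the fast path, the dependencies of one verified set occur in any other one. -/
theorem Inv.result_subset_of_fastDeps (inv : Inv h rule byz σ) (hbyz : byz.card ≤ f)
    {dp : DepPropose f H} {dv dv' : Finset (DepVerify f H)}
    (hv : Verified h σ s dp dv) (hv' : Verified h σ s dp dv') (hf : FastDeps rule dp dv) :
    rule.result (some dp) dv ⊆ rule.result (some dp) dv' := by
  classical
  intro d hd
  simp only [DepRule.result, Option.elim_some, Finset.mem_union] at hd ⊢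
  -- Both sides have the same DepPropose, so its contribution is common to them.
  by_cases hb : d ∈ rule.base dp
  · exact .inl hb
  refine .inr ?_
  have hcard := hf d (hd.resolve_left hb) hb
  rw [← Finset.card_image_of_injOn (f := DepVerify.sender)
    (hv.2.2.1.mono (Finset.coe_subset.2 (Finset.filter_subset _ _)))] at hcard
  obtain ⟨j, hj, hjb⟩ := exists_correct hbyz hcard
  obtain ⟨m, hm, e⟩ := Finset.mem_image.1 hj
  obtain ⟨hm, hdm⟩ := Finset.mem_filter.1 hm
  obtain ⟨k₁, k₂, k₃, _⟩ := hv.2.2.2 m hm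
  -- The correct reporter is in the fast-path quorum, so `dv'` contains a DepVerify of it too,
  -- necessarily the same one.
  obtain ⟨m', hm', e'⟩ := hv'.exists_sender (e ▸ k₃)
  obtain ⟨k₁', k₂', _, _⟩ := hv'.2.2.2 m' hm'
  have := (inv j hjb s).verify_unique m m' k₁ k₁' e k₂ e' k₂'
  subst this
  exact Finset.mem_biUnion.2 ⟨m, hm', hdm⟩

/-- All fast-path certificates of a slot have the same outcome. -/
theorem Inv.outcome_eq_of_fastDeps (inv : Inv h rule byz σ) (hh : h.CollisionFree)
    (hbyz : byz.card ≤ f) {dp dp' : DepPropose f H} {r r' : Req}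
    {dv dv' : Finset (DepVerify f H)}
    (hv : ValidContent h σ s (some (dp, r)) dv) (hv' : ValidContent h σ s (some (dp', r')) dv')
    (hf : FastDeps rule dp dv) (hf' : FastDeps rule dp' dv') :
    outcome rule (some (dp, r)) dv = outcome rule (some (dp', r')) dv' := by
  obtain rfl := inv.propose_eq_of_verified hh hbyz hv.1 hv'.1
  obtain rfl := hh.1 (hv.2.trans hv'.2.symm)
  refine Prod.ext rfl (Finset.Subset.antisymm ?_ ?_)
  · exact inv.result_subset_of_fastDeps hbyz hv.1 hv'.1 hf
  · exact inv.result_subset_of_fastDeps hbyz hv'.1 hv.1 hf'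

end verified

/-! ### Agreement between a commit and later views -/

/-- Some valid content with hash `x` has outcome `R`. -/
def HashOutcome (h : Hash f Req H) (rule : DepRule) (σ : State f Req H) (s : Slot f) (x : H)
    (R : Option Req × Finset (Slot f)) : Prop :=
  ∃ p dv, ValidContent h σ s p dv ∧ h.verifies dv = x ∧ outcome rule p dv = R

section agreement

variable {h : Hash f Req H} {rule : DepRule} {byz : Finset (Replica f)} {σ : State f Req H}
  {s : Slot f}

/-- The hash of the `DepVerify`s determines the outcome. For `f = 0` this fails, since a verified
proposal has no `DepVerify`s, like the no-op. -/
theorem HashOutcome.unique (hh : h.CollisionFree) (hf : 1 ≤ f) {x : H}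
    {R R' : Option Req × Finset (Slot f)} (hR : HashOutcome h rule σ s x R)
    (hR' : HashOutcome h rule σ s x R') : R = R' := by
  obtain ⟨p, dv, hv, rfl, rfl⟩ := hR
  obtain ⟨p', dv', hv', e, rfl⟩ := hR'
  obtain rfl := hh.2.2 e
  congr 1
  have hne : ∀ {dp}, Verified h σ s dp dv' → dv'.Nonempty := fun hd =>
    Finset.card_pos.1 (by rw [hd.2.1]; omega)
  rcases p with _ | ⟨dp, r⟩ <;> rcases p' with _ | ⟨dp', r'⟩
  · rfl
  · exact absurd hv (hne hv'.1).ne_empty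
  · exact absurd hv' (hne hv.1).ne_empty
  -- Any DepVerify contains the hash of its DepPropose, which contains the hash of the request.
  · obtain ⟨m, hm⟩ := hne hv.1
    obtain rfl := hh.2.1 ((hv.1.2.2.2 m hm).2.2.2.symm.trans (hv'.1.2.2.2 m hm).2.2.2)
    obtain rfl := hh.1 (hv.2.trans hv'.2.symm)
    rfl

/-- Every `Prepare` of a correct replica in a view above `v` has a hash with outcome `R` in `σ`. -/
def PreparesAgree (h : Hash f Req H) (rule : DepRule) (byz : Finset (Replica f))
    (σ τ : State f Req H) (s : Slot f) (v : ℤ) (R : Option Req × Finset (Slot f)) : Prop :=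
  ∀ j ∉ byz, ∀ w x, v < w → .prepare ⟨w, s, j, x⟩ ∈ τ.sent → HashOutcome h rule σ s x R

/-- If every `NewView` for a view above `v` that is valid at an earlier time `τ` carries the outcome
`R`, provided that the `Prepare`s sent before `τ` do, then all `Prepare`s above `v` do. -/
theorem preparesAgree_of_newView {v : ℤ} {R : Option Req × Finset (Slot f)}
    (hv : -1 ≤ v)
    (hN : ∀ τ : State f Req H, τ.sent ⊆ σ.sent → PreparesAgree h rule byz σ τ s v R →
      ∀ m, ValidNewView h rule τ m → m.slot = s → v < m.view →
        HashOutcome h rule σ s (h.verifies m.verifies) R)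
    {τ : State f Req H} (hτ : Later h rule byz (State.initial f Req H) τ)
    (hs : τ.sent ⊆ σ.sent) : PreparesAgree h rule byz σ τ s v R := by
  -- The induction is on time, not on views: the Prepares in a certificate were sent before the
  -- NewView, whatever view they claim. The outcome refers to the final state `σ`, as the commit may
  -- come after these Prepares.
  induction hτ with
  | refl => intro j _ w x _ hx; exact absurd hx (by simp [State.initial])
  | @tail τ τ' hτ st ih =>
    have hs' := st.sent_subset.trans hs
    have ih := ih hs'
    intro j hj w x hw hx
    cases st
    case byzantine m faulty =>
      rcases hx with rfl | hx
      · exact absurd faulty hj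
      · exact ih j hj w x hw hx
    case acceptNewView i m correct sent view phase valid =>
      rcases hx with hx | hx
      · exact ih j hj w x hw hx
      · cases hx
        exact hN τ hs' ih m valid rfl hw
    -- This Prepare is of view `-1 ≤ v`, hence not above `v`.
    case rpVerify i s' dp correct view phase propose verified slow =>
      rcases hx with hx | hx
      · exact ih j hj w x hw hx
      · cases hx
        omega
    all_goals
      rcases hx with hx | hx
      · exact ih j hj w x hw hx
      · simp at hx

/-- After a commit in view `v`, later views can only prepare the same outcome. -/
theorem Inv.preparesAgree_of_commitQuorum (inv : Inv h rule byz σ) (hbyz : byz.card ≤ f) {v : ℤ}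
    {x : H} {R : Option Req × Finset (Slot f)} (hx : CommitQuorum σ s v x)
    (hR : HashOutcome h rule σ s x R)
    (hσ : Later h rule byz (State.initial f Req H) σ) : PreparesAgree h rule byz σ σ s v R := by
  have hprep := inv.preparedBy_of_commitQuorum hbyz hx
  have hv : -1 ≤ v := by
    obtain ⟨j, hj, hm⟩ := hprep.exists_correct hbyz
    exact ((inv j hj s).prepare_state v x hm).1
  refine preparesAgree_of_newView hv ?_ hσ subset_rfl
  rintro τ hs ih m hm rfl hw
  obtain ⟨Q, hQ, hcommit⟩ := hx
  obtain ⟨j, hj, hjQ, c, hc, hsent⟩ := hm.exists_correct hbyz hQ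
  obtain ⟨p, dv, prep, w, rfl, hle⟩ :=
    (inv j hj m.slot).viewChange_commit _ c v x (hs hsent) (hcommit j hjQ) hw
  obtain ⟨_, _, _, hvc, hsel⟩ := hm
  rcases hsel with ⟨m', hm', prep', w', hc', hmax⟩ | ⟨hno, _⟩ | ⟨hno, _⟩
  · have hp := ((hvc m' hm').2.2.2 _ hc').preparedBy
    -- The correct member of the Commit quorum supplied an RPC of view at least `v`, so the highest
    -- one is of view `v` or above.
    rcases (hle.trans (hmax _ hc _ _ _ _ rfl)).eq_or_lt with rfl | hlt
    · rwa [← inv.preparedBy_unique hbyz hprep (hp.mono hs)]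
    · obtain ⟨k, hk, hkm⟩ := hp.exists_correct hbyz
      exact ih k hk w' _ hlt hkm
  · exact absurd rfl (hno _ hc _ _ _ _)
  · cases hno _ hc

/-- After a commit on the fast path, later views can only prepare the same outcome. -/
theorem Inv.preparesAgree_of_depCommitQuorum (inv : Inv h rule byz σ) (hh : h.CollisionFree)
    (hbyz : byz.card ≤ f) {dp : DepPropose f H} {r : Req} {dv : Finset (DepVerify f H)}
    (hx : DepCommitQuorum σ s (h.verifies dv)) (hcont : ValidContent h σ s (some (dp, r)) dv)
    (hfast : FastDeps rule dp dv) (hσ : Later h rule byz (State.initial f Req H) σ) :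
    PreparesAgree h rule byz σ σ s (-1) (outcome rule (some (dp, r)) dv) := by
  refine preparesAgree_of_newView le_rfl ?_ hσ subset_rfl
  rintro τ hs ih m hm rfl hw
  obtain ⟨Q, hQ, hcommit⟩ := id hx
  obtain ⟨j, hj, hjQ, c, hc, hsent⟩ := hm.exists_correct hbyz hQ
  have hkeep := (inv j hj m.slot).viewChange_depCommit _ c _ (hs hsent) (hcommit j hjQ)
  have hcont' := hm.validContent.mono hs
  obtain ⟨_, _, _, hvc, hsel⟩ := hm
  rcases hsel with ⟨m', hm', prep', w', hc', hmax⟩ | ⟨hno, m', hm', dp', r', hc', hp⟩ | ⟨hno, _⟩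
  · have hp := ((hvc m' hm').2.2.2 _ hc').preparedBy
    obtain ⟨k, hk, hkm⟩ := hp.exists_correct hbyz
    have hge := ((inv k hk m.slot).prepare_state w' _ (hs hkm)).1
    rcases hge.eq_or_lt with rfl | hlt
    · exact absurd (hp.mono hs) (inv.not_preparedBy_of_depCommitQuorum hbyz hx)
    · exact ih k hk w' _ hlt hkm
  -- The selected FPC need not be that of the correct quorum member; all FPCs of the slot have the
  -- same outcome.
  · rw [hp] at hcont'
    have hfast' := ((hvc m' hm').2.2.2 _ hc').2.2
    exact ⟨_, _, hcont', rfl, inv.outcome_eq_of_fastDeps hh hbyz hcont' hcont hfast' hfast⟩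
  · have := hno _ hc
    simp only at this
    subst this
    simp [KeepsDepCommit] at hkeep

/-- Within one view, or twice on the fast path, quorum intersection gives equal hashes. Otherwise a
Commit quorum in the higher view presupposes a Prepare of a correct replica there, to which
`PreparesAgree` applies. -/
theorem Inv.committed_unique (inv : Inv h rule byz σ) (hh : h.CollisionFree) (hf : 1 ≤ f)
    (hbyz : byz.card ≤ f) (hσ : Later h rule byz (State.initial f Req H) σ)
    {R R' : Option Req × Finset (Slot f)} (hR : Committed h rule σ s R)
    (hR' : Committed h rule σ s R') : R = R' := by
  have fast_recon : ∀ {dp r dv x R'}, DepCommitQuorum σ s (h.verifies dv) →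
      ValidContent h σ s (some (dp, r)) dv → FastDeps rule dp dv → ∀ v, CommitQuorum σ s v x →
      HashOutcome h rule σ s x R' → outcome rule (some (dp, r)) dv = R' := by
    intro dp r dv x R' hq hcont hfast v hx hR'
    have hp := inv.preparedBy_of_commitQuorum hbyz hx
    obtain ⟨j, hj, hm⟩ := hp.exists_correct hbyz
    rcases ((inv j hj s).prepare_state v x hm).1.eq_or_lt with rfl | hlt
    · exact absurd hp (inv.not_preparedBy_of_depCommitQuorum hbyz hq)
    · exact (inv.preparesAgree_of_depCommitQuorum hh hbyz hq hcont hfast hσ j hj v x hlt hm).unique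
        hh hf hR'
  have recon_lt : ∀ {x x' R R' v v'}, CommitQuorum σ s v x → HashOutcome h rule σ s x R →
      CommitQuorum σ s v' x' → HashOutcome h rule σ s x' R' → v < v' → R = R' := by
    intro x x' R R' v v' hx hR hx' hR' hlt
    obtain ⟨j, hj, hm⟩ := (inv.preparedBy_of_commitQuorum hbyz hx').exists_correct hbyz
    exact (inv.preparesAgree_of_commitQuorum hbyz hx hR hσ j hj v' x' hlt hm).unique hh hf hR'
  obtain ⟨p, dv, hcont, rfl, hq⟩ := hR
  obtain ⟨p', dv', hcont', rfl, hq'⟩ := hR'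
  have ho : HashOutcome h rule σ s (h.verifies dv) (outcome rule p dv) := ⟨p, dv, hcont, rfl, rfl⟩
  have ho' : HashOutcome h rule σ s (h.verifies dv') (outcome rule p' dv') :=
    ⟨p', dv', hcont', rfl, rfl⟩
  rcases hq with ⟨hq, dp, r, rfl, hfast⟩ | ⟨v, hq⟩ <;>
    rcases hq' with ⟨hq', dp', r', rfl, hfast'⟩ | ⟨v', hq'⟩
  · exact ho.unique hh hf (inv.depCommitQuorum_unique hbyz hq hq' ▸ ho')
  · exact fast_recon hq hcont hfast v' hq' ho'
  · exact (fast_recon hq' hcont' hfast' v hq ho).symm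
  · rcases lt_trichotomy v v' with hlt | rfl | hlt
    · exact recon_lt hq ho hq' ho' hlt
    · exact ho.unique hh hf (inv.preparedBy_unique hbyz (inv.preparedBy_of_commitQuorum hbyz hq)
        (inv.preparedBy_of_commitQuorum hbyz hq') ▸ ho')
    · exact (recon_lt hq' ho' hq ho hlt).symm

end agreement

/-! ### A single replica: the case `f = 0` -/

/-- The content of an optional certificate; without one, the no-op. -/
def certContent : Option (Certificate f Req H) → Proposal f Req H × Finset (DepVerify f H)
  | none => (none, ∅)
  | some (.fpc dp r dv) => (some (dp, r), dv)
  | some (.rpc p dv _ _) => (p, dv)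

/-- The only content that a replica without peers can still commit. -/
def SlotState.Settled (l : SlotState f Req H) (p : Proposal f Req H)
    (dv : Finset (DepVerify f H)) : Prop :=
  (l.phase = .viewChange ∧ certContent l.cert = (p, dv)) ∨
    ((l.phase.IsFast ∨ l.phase.IsRecon ∧ certContent l.cert = (p, dv)) ∧
      l.propose = p.map Prod.fst ∧ l.request = p.map Prod.snd ∧ l.verifies = dv)

theorem proposal_eq {p p' : Proposal f Req H} (h₁ : p.map Prod.fst = p'.map Prod.fst)
    (h₂ : p.map Prod.snd = p'.map Prod.snd) : p = p' := by
  rcases p with _ | ⟨_, _⟩ <;> rcases p' with _ | ⟨_, _⟩ <;> simp_all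

/-- In a fast phase the stored proposal, request and DepVerifys determine the content; in the other
settled phases the certificate does. -/
theorem SlotState.Settled.unique {l : SlotState f Req H} {p p' : Proposal f Req H}
    {dv dv' : Finset (DepVerify f H)} (hl : l.Settled p dv) (hl' : l.Settled p' dv') :
    p = p' ∧ dv = dv' := by
  have := @proposal_eq f Req H p p'
  unfold SlotState.Settled Phase.IsFast Phase.IsRecon at *
  grind

section singleReplica

instance : Subsingleton (Replica 0) := inferInstanceAs (Subsingleton (Fin 1))

variable {h : Hash 0 Req H} {rule : DepRule} {byz : Finset (Replica 0)} {σ σ' : State 0 Req H}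

/-- A `NewView` for the current view of the only replica has the content of its certificate. -/
theorem LocalInv.newView_content {i : Replica 0} {m : NewView 0 Req H}
    (inv : LocalInv h rule σ i m.slot (σ.loc i m.slot)) (hm : ValidNewView h rule σ m)
    (view : (σ.loc i m.slot).view = m.view) :
    certContent (σ.loc i m.slot).cert = (m.proposal, m.verifies) := by
  obtain ⟨_, hcard, _, hvc, hsel⟩ := hm
  -- All these ViewChanges come from the only replica and are for its current view, where
  -- `viewChange_state` ties them to the stored certificate.
  have hcert : ∀ c ∈ m.vcs, c.cert = (σ.loc i m.slot).cert := by
    rintro ⟨v, s, j, c⟩ hc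
    obtain ⟨h₁, h₂, h₃, _⟩ := hvc _ hc
    obtain rfl := Subsingleton.elim j i
    simp only at h₂ h₃
    subst h₂ h₃
    exact (inv.viewChange_state _ c h₁).2.2 view.symm
  rcases hsel with ⟨m', hm', prep, w, hc, _⟩ | ⟨_, m', hm', dp, r, hc, hp⟩ | ⟨hno, hp, hdv⟩
  · rw [← hcert m' hm', hc, certContent]
  · rw [← hcert m' hm', hc, certContent, hp]
  · obtain ⟨m', hm'⟩ := Finset.card_pos.1 (show 0 < m.vcs.card by omega)
    rw [← hcert m' hm', hno m' hm', certContent, hp, hdv]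

/-- Leaving a view moves the content into the certificate or keeps a certificate that already has
it, and a NewView returns the content of that certificate. -/
theorem SlotState.Settled.step (inv : Inv h rule byz σ) {i : Replica 0} {s : Slot 0}
    {p : Proposal 0 Req H} {dv : Finset (DepVerify 0 H)}
    (hl : (σ.loc i s).Settled p dv) (st : Step h rule byz σ σ') : (σ'.loc i s).Settled p dv := by
  have upd : ∀ (i' : Replica 0) (s' : Slot 0) (l : SlotState 0 Req H) (ms : Set (Msg 0 Req H)),
      ((σ.loc i' s').Settled p dv → l.Settled p dv) →
      ((σ.update i' s' l ms).loc i s).Settled p dv := by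
    intro i' s' l ms himp
    by_cases e : i = i' ∧ s = s'
    · obtain ⟨rfl, rfl⟩ := e
      rw [State.update_loc_self]
      exact himp hl
    · rwa [State.update_loc_of_ne _ _ _ e]
  cases st
  case byzantine => exact hl
  case acceptNewView i' m correct sent view phase valid =>
    refine upd _ _ _ _ fun hl => ?_
    have := (inv i' correct m.slot).newView_content valid view
    unfold SlotState.Settled Phase.IsFast Phase.IsRecon at *
    grind
  case startViewChange i' s' v c correct higher cert =>
    refine upd _ _ _ _ fun hl => ?_
    have h₁ := @proposal_eq 0 Req H p
    have h₂ : ∀ dp r, p.map Prod.fst = some dp → p.map Prod.snd = some r → p = some (dp, r) :=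
      fun dp r => @h₁ (some (dp, r))
    clear upd
    unfold SlotState.Settled Phase.IsFast Phase.IsRecon at *
    unfold UpdatedCert at cert
    cases hp : (σ.loc i' s').phase <;> simp only [hp] at cert hl <;> grind [certContent]
  all_goals
    refine upd _ _ _ _ fun hl => ?_
    unfold SlotState.Settled Phase.IsFast Phase.IsRecon at *
    grind

/-- Without peers, a result that is committed or reported is the settled one. -/
def SettledInv (rule : DepRule) (σ : State 0 Req H) : Prop :=
  ∀ i s, ((σ.loc i s).phase.IsRecon → ∃ p dv, (σ.loc i s).Settled p dv) ∧
    ∀ c D, ((σ.loc i s).exec = some (c, D) ∨ .exec ⟨s, i, c, D⟩ ∈ σ.sent) →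
      ∃ p dv, (σ.loc i s).Settled p dv ∧ outcome rule p dv = (c, D)

theorem SettledInv.step (inv : Inv h rule byz σ) (hbyz : byz.card ≤ 0)
    (si : SettledInv rule σ) (st : Step h rule byz σ σ') : SettledInv rule σ' := by
  obtain rfl : byz = ∅ := Finset.card_eq_zero.1 (Nat.le_zero.1 hbyz)
  have keep : ∀ i s p dv, (σ.loc i s).Settled p dv → (σ'.loc i s).Settled p dv :=
    fun i s p dv hl => hl.step inv st
  have upd : ∀ (i : Replica 0) (s : Slot 0) (l : SlotState 0 Req H) (ms : Set (Msg 0 Req H)),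
      σ' = σ.update i s l ms →
      (l.phase.IsRecon → (σ.loc i s).phase.IsRecon ∨ ∃ p dv, l.Settled p dv) →
      (∀ c D, l.exec = some (c, D) → (σ.loc i s).exec = some (c, D) ∨
        ∃ p dv, l.Settled p dv ∧ outcome rule p dv = (c, D)) →
      (∀ m, .exec m ∈ ms → m.slot = s ∧ (σ.loc i s).exec = some (m.request, m.deps)) →
      SettledInv rule σ' := by
    intro i s l ms e hrec hex hms i' s'
    obtain rfl := Subsingleton.elim i i'
    have old : ∀ s' c D, ((σ.loc i s').exec = some (c, D) ∨ .exec ⟨s', i, c, D⟩ ∈ σ.sent) →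
        ∃ p dv, (σ'.loc i s').Settled p dv ∧ outcome rule p dv = (c, D) := by
      intro s' c D hc
      obtain ⟨p, dv, h₁, h₂⟩ := (si i s').2 c D hc
      exact ⟨p, dv, keep i s' p dv h₁, h₂⟩
    have hself : σ'.loc i s = l := by rw [e, State.update_loc_self]
    have hother : s' ≠ s → σ'.loc i s' = σ.loc i s' := fun hne => by
      rw [e, State.update_loc_of_ne _ _ _ (fun hh => hne hh.2)]
    refine ⟨fun hp => ?_, ?_⟩
    · by_cases hs : s' = s
      · subst hs
        rcases hrec (hself ▸ hp) with h₁ | h₁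
        · obtain ⟨p, dv, h₂⟩ := (si i s').1 h₁
          exact ⟨p, dv, keep _ _ _ _ h₂⟩
        · rwa [hself]
      · obtain ⟨p, dv, h₂⟩ := (si i s').1 (hother hs ▸ hp)
        exact ⟨p, dv, keep _ _ _ _ h₂⟩
    · rintro c D (hc | hc)
      · by_cases hs : s' = s
        · subst hs
          rcases hex c D (hself ▸ hc) with h₁ | h₁
          · exact old s' c D (.inl h₁)
          · rwa [hself]
        · exact old s' c D (.inl (hother hs ▸ hc))
      · rw [e] at hc
        rcases hc with hc | hc
        · exact old s' c D (.inr hc)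
        · obtain ⟨rfl, h₁⟩ := hms _ hc
          exact old _ c D (.inl h₁)
  cases st
  case byzantine m faulty => simp at faulty
  case fpCommit i s Q correct view phase size quorum =>
    refine upd i s _ _ rfl (by simp [Phase.IsRecon]) (fun c D hc => .inr ?_) (by simp)
    obtain ⟨_, dp, r, h₁, h₂, _⟩ := (inv i correct s).fast (.inl phase)
    refine ⟨some (dp, r), (σ.loc i s).verifies, .inr ⟨.inl (.inr rfl), h₁, h₂, rfl⟩, ?_⟩
    rw [← Option.some.inj hc]
    simp [outcome, h₁, h₂]
  case rpVerify i s dp correct view phase propose verified slow =>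
    -- With `2f = 0` DepVerifys the fast-path condition is vacuous, so reconciliation never starts
    -- in view `-1`.
    refine absurd ?_ slow
    have : (σ.loc i s).verifies = ∅ := by simpa using verified.2.1
    simp [FastDeps, this]
  case rpCommit i s Q correct phase size quorum =>
    refine upd i s _ _ rfl (fun _ => .inl (.inr (.inl phase))) (fun c D hc => .inr ?_) (by simp)
    obtain ⟨p, dv, hset⟩ := (si i s).1 (.inr (.inl phase))
    refine ⟨p, dv, ?_, ?_⟩
    · simpa [State.update_loc_self] using keep i s p dv hset
    · rw [← Option.some.inj hc]
      unfold SlotState.Settled Phase.IsFast Phase.IsRecon at hset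
      grind [outcome]
  case acceptNewView i m correct sent view phase valid =>
    refine upd i m.slot _ _ rfl (fun _ => .inr ?_) (fun c D hc => .inl hc) (by simp)
    -- Accepting a NewView is thus the only entry to the reconciliation path, and it settles the
    -- content.
    exact ⟨m.proposal, m.verifies, .inr ⟨.inr ⟨.inl rfl,
      (inv i correct m.slot).newView_content valid view⟩, rfl, rfl, rfl⟩⟩
  case sendExec i s c D correct exec =>
    refine upd i s _ _ rfl (fun hp => .inl hp) (fun c D hc => .inl hc) ?_
    rintro m hm
    cases hm
    exact ⟨rfl, exec⟩
  case receiveExec i s c D Q correct size quorum =>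
    refine upd i s _ _ rfl (fun hp => .inl hp) ?_ (by simp)
    intro c' D' hc
    cases hc
    obtain ⟨j, hj⟩ := Finset.card_pos.1 (show 0 < Q.card by omega)
    obtain rfl := Subsingleton.elim j i
    obtain ⟨p, dv, h₁, h₂⟩ := (si j s).2 c D (.inr (quorum j hj))
    exact .inr ⟨p, dv, by simpa [State.update_loc_self] using keep j s p dv h₁, h₂⟩
  case rpPrepare i s Q correct phase size quorum =>
    exact upd i s _ _ rfl (fun _ => .inl (.inl phase)) (fun c D hc => .inl hc) (by simp)
  case sendNewView i m correct sender view phase valid =>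
    exact upd i m.slot _ _ rfl (fun hp => .inl hp) (fun c D hc => .inl hc) (by simp)
  case receiveVerify i s dp m correct view phase propose sent slot quorum hash first =>
    exact upd i s _ _ rfl (fun hp => .inl hp) (fun c D hc => .inl hc) (by simp)
  all_goals
    exact upd _ _ _ _ rfl (by simp [Phase.IsRecon]) (fun c D hc => .inl hc) (by simp)

theorem Later.settledInv (hbyz : byz.card ≤ 0)
    (hσ : Later h rule byz (State.initial 0 Req H) σ) : SettledInv rule σ := by
  induction hσ with
  | refl => intro i s; simp [State.initial, SlotState.initial, Phase.IsRecon]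
  | tail hσ st ih => exact ih.step (Later.inv hσ) hbyz st

theorem Later.settled
    (hσ : Later h rule byz (State.initial 0 Req H) σ) (hσ' : Later h rule byz σ σ')
    {i : Replica 0} {s : Slot 0} {p : Proposal 0 Req H} {dv : Finset (DepVerify 0 H)}
    (hl : (σ.loc i s).Settled p dv) : (σ'.loc i s).Settled p dv := by
  induction hσ' with
  | refl => exact hl
  | tail hτ st ih => exact ih.step (Later.inv (hσ.trans hτ)) st

end singleReplica

end Isos

/-! ### Consistency -/

/-- Consistency: if at some time of a run the correct replica `i` has committed `(c, D)` for slot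
`s`, and at the same or a later time the correct replica `k` has committed `(c', D')` for `s`, each
on any path, then `c = c'` and `D = D'`. -/
theorem mainTheorem1 {f : ℕ} {Req H : Type*} (h : Isos.Hash f Req H) (hh : h.CollisionFree)
    (rule : Isos.DepRule) (byz : Finset (Isos.Replica f)) (hbyz : byz.card ≤ f)
    (σ σ' : Isos.State f Req H)
    (hσ : Isos.Later h rule byz (Isos.State.initial f Req H) σ)
    (hσ' : Isos.Later h rule byz σ σ')
    (i k : Isos.Replica f) (hi : i ∉ byz) (hk : k ∉ byz) (s : Isos.Slot f)
    (c c' : Option Req) (D D' : Finset (Isos.Slot f))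
    (hc : (σ.loc i s).exec = some (c, D)) (hc' : (σ'.loc k s).exec = some (c', D')) :
    c = c' ∧ D = D' := by
  have hrun : Isos.Later h rule byz (Isos.State.initial f Req H) σ' := hσ.trans hσ'
  rw [← Prod.mk.injEq]
  rcases Nat.eq_zero_or_pos f with rfl | hf
  · obtain rfl := Subsingleton.elim i k
    obtain ⟨p, dv, hset, ho⟩ := (Isos.Later.settledInv hbyz hσ i s).2 c D (.inl hc)
    obtain ⟨p', dv', hset', ho'⟩ := (Isos.Later.settledInv hbyz hrun i s).2 c' D' (.inl hc')
    -- Content settled at `σ` is still settled at `σ'`, where it is unique.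
    obtain ⟨rfl, rfl⟩ := (Isos.Later.settled hσ hσ' hset).unique hset'
    exact ho.symm.trans ho'
  -- Messages persist, so the earlier commit is still justified at `σ'` and both can be compared
  -- there.
  · exact (Isos.Later.inv hrun).committed_unique hh hf hbyz hrun
      ((Isos.Later.execInv hbyz hσ i hi s c D (.inl hc)).mono (Isos.Later.sent_subset hσ'))
      (Isos.Later.execInv hbyz hrun k hk s c' D' (.inl hc'))
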